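/- A \emph{dendrite} is a nonempty locally connected compact connected metrizable space that contains no simple closed curve; equivalently, it is a nonempty compact connected metrizable space in which any two distinct points are separated by a third point. For a continuum $Y$ and $x\in Y$ let $\mathrm{val}_Y(x)$ be the number of connected components of $Y\setminus\{x\}$; $x$ is an \emph{endpoint} of $Y$ if $\mathrm{val}_Y(x)=1$ and a \emph{cutpoint} of $Y$ if $\mathrm{val}_Y(x)>1$. Let $D_1\subset D_2$ be dendrites, where $D_1$ has more than one point, and let $f:D_1\to D_2$ be continuous. Put $E=\overline{D_2\setminus D_1}\cap D_1$. Suppose that (1) $f$ \emph{scrambles the boundary}: for every $e\in E$ with $f(e)\ne e$, the point $f(e)$ lies in a component of $D_2\setminus\{e\}$ which meets $D_1$; and (2) every endpoint $a$ of $D_1$ with $f(a)=a$ is a \emph{weakly repelling fixed point of $f$}: there is a component $B$ of $D_1\setminus\{a\}$ such that every neighborhood of $a$ contains a point $x\in B$ which either is a cutpoint of $D_1$ with $f(x)=x$, or separates $a$ from $f(x)$ in $D_2$. Then there is a cutpoint $c$ of $D_1$ with $f(c)=c$. -/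

import Mathlib

open Set Topology

namespace DendriteFixedPoint

/-- The point `z` separates `p` from `q` in `X`: the complement of `z` is the union of two
disjoint open sets, one containing `p` and the other containing `q` (so `z ≠ p`, `z ≠ q`). -/
def Separates {X : Type*} [TopologicalSpace X] (z p q : X) : Prop :=
  ∃ U V : Set X, IsOpen U ∧ IsOpen V ∧ Disjoint U V ∧ U ∪ V = {z}ᶜ ∧ p ∈ U ∧ q ∈ V

/-- A dendrite: a (nonempty) metrizable continuum in which any two distinct points are separated
by a third point. Equivalently, a locally connected metrizable continuum that contains no simple
closed curve. One-point spaces are allowed here. -/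
structure IsDendrite (X : Type*) [TopologicalSpace X] : Prop where
  compactSpace : CompactSpace X
  connectedSpace : ConnectedSpace X
  metrizableSpace : TopologicalSpace.MetrizableSpace X
  exists_separates : ∀ p q : X, p ≠ q → ∃ z : X, Separates z p q

/-- The set of connected components of a subset `S`. -/
def components {X : Type*} [TopologicalSpace X] (S : Set X) : Set (Set X) :=
  connectedComponentIn S '' S

/-- `valence Y x` is the number of connected components of `Y \ {x}`. -/
noncomputable def valence {X : Type*} [TopologicalSpace X] (Y : Set X) (x : X) : ℕ∞ :=
  (components (Y \ {x})).encard

/-- `x` is an endpoint of `Y`. -/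
def IsEndpoint {X : Type*} [TopologicalSpace X] (Y : Set X) (x : X) : Prop :=
  x ∈ Y ∧ valence Y x = 1

/-- `x` is a cutpoint of `Y`. -/
def IsCutpoint {X : Type*} [TopologicalSpace X] (Y : Set X) (x : X) : Prop :=
  x ∈ Y ∧ 1 < valence Y x

/-- The set `E` of points at which the whole space `X` grows out of `D₁`. -/
def growthSet {X : Type*} [TopologicalSpace X] (D₁ : Set X) : Set X :=
  closure (univ \ D₁) ∩ D₁

/-- `f : D₁ → X` scrambles the boundary: every non-fixed point `e` of `growthSet D₁` is mapped
into a component of `X \ {e}` that meets `D₁`. -/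
def ScramblesBoundary {X : Type*} [TopologicalSpace X] {D₁ : Set X} (f : D₁ → X) : Prop :=
  ∀ e : D₁, (e : X) ∈ growthSet D₁ → f e ≠ e →
    ∃ C ∈ components (univ \ {(e : X)}), f e ∈ C ∧ (C ∩ D₁).Nonempty

/-- `a` is a weakly repelling fixed point of `f : D₁ → X` in `B`: `a` is fixed, `B` is a component
of `D₁ \ {a}`, and arbitrarily close to `a` there are points `x` of `B` that are fixed cutpoints
of `D₁` or separate `a` from `f x` in `X`. -/
def IsWeaklyRepellingIn {X : Type*} [TopologicalSpace X] {D₁ : Set X} (f : D₁ → X)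
    (a : D₁) (B : Set X) : Prop :=
  f a = a ∧ B ∈ components (D₁ \ {(a : X)}) ∧
    ∀ U ∈ 𝓝 (a : X), ∃ x : D₁, (x : X) ∈ U ∩ B ∧
      ((f x = x ∧ IsCutpoint D₁ (x : X)) ∨ Separates (x : X) (a : X) (f x))

/-- `a` is a weakly repelling fixed point of `f : D₁ → X`. -/
def IsWeaklyRepelling {X : Type*} [TopologicalSpace X] {D₁ : Set X} (f : D₁ → X)
    (a : D₁) : Prop :=
  ∃ B : Set X, IsWeaklyRepellingIn f a B

end DendriteFixedPoint

namespace DendriteFixedPoint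

section Separation

variable {X : Type*} [TopologicalSpace X] {p q r w z d e : X}

theorem Separates.symm (h : Separates z p q) : Separates z q p := by
  obtain ⟨U, V, hU, hV, hd, hu, hp, hq⟩ := h
  exact ⟨V, U, hV, hU, hd.symm, by rw [union_comm, hu], hq, hp⟩

theorem Separates.ne_left (h : Separates z p q) : p ≠ z := by
  obtain ⟨U, V, -, -, -, hu, hp, -⟩ := h
  have : p ∈ ({z}ᶜ : Set X) := hu ▸ Or.inl hp
  simpa using this

theorem Separates.ne_right (h : Separates z p q) : q ≠ z := h.symm.ne_left

theorem Separates.left_or_right (h : Separates z p q) (hr : r ≠ z) :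
    Separates z p r ∨ Separates z r q := by
  obtain ⟨U, V, hU, hV, hd, hu, hp, hq⟩ := h
  have : r ∈ U ∪ V := by rw [hu]; simpa using hr
  rcases this with h | h
  · exact Or.inr ⟨U, V, hU, hV, hd, hu, h, hq⟩
  · exact Or.inl ⟨U, V, hU, hV, hd, hu, hp, h⟩

theorem isOpen_setOf_separates_right (z p : X) : IsOpen {q | Separates z p q} := by
  rw [isOpen_iff_mem_nhds]
  rintro q ⟨U, V, hU, hV, hd, hu, hp, hq⟩
  filter_upwards [hV.mem_nhds hq] with y hy
  exact ⟨U, V, hU, hV, hd, hu, hp, hy⟩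

theorem isOpen_setOf_separates_left (z q : X) : IsOpen {p | Separates z p q} := by
  have : {p | Separates z p q} = {p | Separates z q p} :=
    Set.ext fun _ => ⟨Separates.symm, Separates.symm⟩
  exact this ▸ isOpen_setOf_separates_right z q

theorem Separates.mem_of_isPreconnected {S : Set X} (hS : IsPreconnected S)
    (h : Separates z p q) (hp : p ∈ S) (hq : q ∈ S) : z ∈ S := by
  by_contra hz
  obtain ⟨U, V, hU, hV, hd, hu, hpU, hqV⟩ := h
  have hsub : S ⊆ U ∪ V := by
    rw [hu]
    rintro x hx rfl
    exact hz hx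
  obtain ⟨x, -, hxU, hxV⟩ := hS U V hU hV hsub ⟨p, hp, hpU⟩ ⟨q, hq, hqV⟩
  exact disjoint_left.1 hd hxU hxV

/-- Of three points of a connected space, at most one separates the other two. -/
theorem Separates.asymm [PreconnectedSpace X] (h : Separates z p q) : ¬ Separates p z q := by
  rintro ⟨U', V', hU', hV', hd', hu', hz', hq'⟩
  obtain ⟨U, V, hU, hV, hd, hu, hp, hq⟩ := h
  have hclosed : IsClosed (V ∩ V') := by
    have : (V ∩ V')ᶜ = U ∪ U' := by
      ext x
      have h1 : x ∈ U ∪ V ↔ x ≠ z := by rw [hu]; simp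
      have h2 : x ∈ U' ∪ V' ↔ x ≠ p := by rw [hu']; simp
      constructor
      · intro hx
        by_cases hxz : x = z
        · exact Or.inr (hxz ▸ hz')
        by_cases hxp : x = p
        · exact Or.inl (hxp ▸ hp)
        rcases h1.2 hxz with h | h
        · exact Or.inl h
        rcases h2.2 hxp with h' | h'
        · exact Or.inr h'
        exact absurd ⟨h, h'⟩ hx
      · rintro (hx | hx) ⟨h, h'⟩
        · exact disjoint_left.1 hd hx h
        · exact disjoint_left.1 hd' hx h'
    rw [← isOpen_compl_iff, this]
    exact hU.union hU'
  have huniv : V ∩ V' = univ := IsClopen.eq_univ ⟨hclosed, hV.inter hV'⟩ ⟨q, hq, hq'⟩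
  have hpV : p ∈ V ∩ V' := huniv ▸ mem_univ p
  exact disjoint_left.1 hd hp hpV.1

theorem Separates.trans [PreconnectedSpace X] (h : Separates w p z) (h' : Separates z p q) :
    Separates w p q := by
  have hwz : ¬ Separates z p w := fun h1 => h.symm.asymm h1.symm
  rcases h.left_or_right (r := q) (by rintro rfl; exact hwz h') with h1 | h1
  · exact h1
  rcases h'.left_or_right (r := w) h.ne_right.symm with h2 | h2
  · exact absurd h2 hwz
  · exact absurd h2 h1.symm.asymm

/-- Two points that separate `p` from `d` are comparable in the order from `p` to `d`. -/
theorem Separates.total [PreconnectedSpace X] (h : Separates z p d) (h' : Separates w p d)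
    (hne : z ≠ w) : Separates z p w ∨ Separates w p z := by
  rcases h.left_or_right hne.symm with h1 | h1
  · exact Or.inl h1
  rcases h'.left_or_right hne with h2 | h2
  · exact Or.inr h2
  · exact absurd h2 h1.asymm

/-- The points `y` and `d` lie in the same direction as seen from `p`: some point separates `p`
from both of them. -/
def SameDirection (p y d : X) : Prop := ∃ z, Separates z p y ∧ Separates z p d

theorem SameDirection.symm (h : SameDirection p q d) : SameDirection p d q :=
  let ⟨z, h1, h2⟩ := h
  ⟨z, h2, h1⟩

theorem SameDirection.trans [PreconnectedSpace X] (h : SameDirection p q d)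
    (h' : SameDirection p d e) : SameDirection p q e := by
  obtain ⟨z, hzq, hzd⟩ := h
  obtain ⟨w, hwd, hwe⟩ := h'
  by_cases hzw : z = w
  · subst hzw; exact ⟨z, hzq, hwe⟩
  rcases hzd.total hwd hzw with h1 | h1
  · exact ⟨z, hzq, h1.trans hwe⟩
  · exact ⟨w, h1.trans hzq, hwe⟩

theorem isOpen_setOf_sameDirection (p d : X) : IsOpen {y | SameDirection p d y} := by
  rw [isOpen_iff_mem_nhds]
  rintro y ⟨z, hd, hy⟩
  filter_upwards [(isOpen_setOf_separates_right z p).mem_nhds hy] with x hx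
  exact ⟨z, hd, hx⟩

theorem isOpen_setOf_not_sameDirection [PreconnectedSpace X]
    (hsep : ∀ p q : X, p ≠ q → ∃ z : X, Separates z p q) (p d : X) :
    IsOpen {y | y ≠ p ∧ ¬ SameDirection p d y} := by
  rw [isOpen_iff_mem_nhds]
  rintro y ⟨hyp, hy⟩
  have hyy : SameDirection p y y := by
    obtain ⟨z, hz⟩ := hsep p y hyp.symm
    exact ⟨z, hz, hz⟩
  filter_upwards [(isOpen_setOf_sameDirection p y).mem_nhds hyy] with x hx
  obtain ⟨z, -, hz⟩ := id hx
  refine ⟨?_, fun h => hy (h.trans hx.symm)⟩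
  rintro rfl
  obtain ⟨U, V, -, -, hd, -, h1, h2⟩ := hz
  exact disjoint_left.1 hd h1 h2

theorem separates_of_not_sameDirection [PreconnectedSpace X]
    (hsep : ∀ p q : X, p ≠ q → ∃ z : X, Separates z p q) (hd : d ≠ p) (hq : q ≠ p)
    (h : ¬ SameDirection p d q) : Separates p d q := by
  refine ⟨{y | SameDirection p d y}, {y | y ≠ p ∧ ¬ SameDirection p d y},
    isOpen_setOf_sameDirection p d, isOpen_setOf_not_sameDirection hsep p d,
    disjoint_left.2 fun x hx hx' => hx'.2 hx, ?_, ?_, hq, h⟩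
  · ext x
    constructor
    · rintro (⟨z, -, hz⟩ | hx)
      · rintro rfl
        obtain ⟨U, V, -, -, hd, -, h1, h2⟩ := hz
        exact disjoint_left.1 hd h1 h2
      · exact hx.1
    · intro hx
      by_cases h : SameDirection p d x
      · exact Or.inl h
      · exact Or.inr ⟨hx, h⟩
  · obtain ⟨z, hz⟩ := hsep p d hd.symm
    exact ⟨z, hz, hz⟩

/-- Every neighbourhood of `p` contains an initial piece of the arc from `p` to `z`. -/
theorem exists_separates_mem_nhds [PreconnectedSpace X] [CompactSpace X]
    (hsep : ∀ p q : X, p ≠ q → ∃ z : X, Separates z p q) (hpz : p ≠ z) {N : Set X}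
    (hN : N ∈ 𝓝 p) :
    ∃ t, Separates t p z ∧ t ∈ N ∧ ∀ v, Separates v p t → v ∈ N := by
  set K : Set X := (interior N ∪ {y | y ≠ p ∧ ¬ SameDirection p z y})ᶜ with hK
  have hKc : IsCompact K :=
    (isOpen_interior.union (isOpen_setOf_not_sameDirection hsep p z)).isClosed_compl.isCompact
  have hmemK : ∀ v, SameDirection p z v → v ∉ N → v ∈ K := by
    rintro v hv hvN (h | h)
    · exact hvN (interior_subset h)
    · exact h.2 hv
  have hdir : ∀ v, Separates v p z → SameDirection p z v := by
    intro v hv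
    obtain ⟨u, hu⟩ := hsep p v hv.ne_left
    exact ⟨u, hu.trans hv, hu⟩
  have : Nonempty {t // Separates t p z} := by
    obtain ⟨t, ht⟩ := hsep p z hpz
    exact ⟨⟨t, ht⟩⟩
  obtain ⟨⟨t, ht⟩, htK⟩ := hKc.elim_directed_cover
    (fun t : {t // Separates t p z} => {y | Separates t.1 p y})
    (fun t => isOpen_setOf_separates_right t.1 p)
    (by
      intro v hv
      have hvN : v ∉ interior N := fun h => hv (Or.inl h)
      have hvp : v ≠ p := by
        rintro rfl
        exact hvN (mem_interior_iff_mem_nhds.2 hN)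
      have : SameDirection p z v := by
        by_contra h
        exact hv (Or.inr ⟨hvp, h⟩)
      obtain ⟨t, h1, h2⟩ := this
      exact mem_iUnion.2 ⟨⟨t, h1⟩, h2⟩)
    (by
      rintro ⟨a, ha⟩ ⟨b, hb⟩
      by_cases hab : a = b
      · subst hab
        exact ⟨⟨a, ha⟩, subset_rfl, subset_rfl⟩
      rcases ha.total hb hab with h | h
      · exact ⟨⟨a, ha⟩, subset_rfl, fun y hy => h.trans hy⟩
      · exact ⟨⟨b, hb⟩, fun y hy => h.trans hy, subset_rfl⟩)
  refine ⟨t, ht, ?_, ?_⟩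
  · by_contra htN
    have : Separates t p t := htK (hmemK t (hdir t ht) htN)
    exact this.ne_right rfl
  · intro v hv
    by_contra hvN
    have h : Separates t p v := htK (hmemK v (hdir v (hv.trans ht)) hvN)
    exact h.symm.asymm hv.symm

/-- The arc from `x` to `y` is closed. -/
theorem isClosed_setOf_separates [PreconnectedSpace X]
    (hsep : ∀ p q : X, p ≠ q → ∃ z : X, Separates z p q) (x y : X) :
    IsClosed {u | u = x ∨ u = y ∨ Separates u x y} := by
  rw [← isOpen_compl_iff, isOpen_iff_mem_nhds]
  intro u hu
  simp only [mem_compl_iff, mem_ofPred_eq, not_or] at hu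
  obtain ⟨hux, huy, hu⟩ := hu
  obtain ⟨v, hvx, hvy⟩ : SameDirection u x y := by
    by_contra h
    exact hu (separates_of_not_sameDirection hsep (Ne.symm hux) (Ne.symm huy) h)
  filter_upwards [(isOpen_setOf_separates_left v x).mem_nhds hvx,
    (isOpen_setOf_separates_left v y).mem_nhds hvy] with s hsx hsy
  rintro (rfl | rfl | h)
  · obtain ⟨U, V, -, -, hd, -, h1, h2⟩ := hsx
    exact disjoint_left.1 hd h1 h2
  · obtain ⟨U, V, -, -, hd, -, h1, h2⟩ := hsy
    exact disjoint_left.1 hd h1 h2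
  · rcases h.left_or_right (r := v) hsx.ne_left.symm with h1 | h1
    · exact hsx.asymm h1.symm
    · exact hsy.asymm h1

theorem exists_maximal_of_finite {α : Type*} {R : α → α → Prop} {T : Set α}
    (hirr : ∀ a ∈ T, ¬ R a a)
    (htrans : ∀ a ∈ T, ∀ b ∈ T, ∀ c ∈ T, R a b → R b c → R a c)
    {F : Set α} (hF : F.Finite) :
    F ⊆ T → F.Nonempty → ∃ m ∈ F, ∀ b ∈ F, ¬ R m b := by
  induction F, hF using Set.Finite.induction_on with
  | empty => exact fun _ h => absurd h not_nonempty_empty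
  | @insert a F _ _ ih =>
    intro hsub _
    have haT : a ∈ T := hsub (mem_insert a F)
    have hFT : F ⊆ T := (subset_insert a F).trans hsub
    rcases F.eq_empty_or_nonempty with rfl | hne
    · exact ⟨a, mem_insert _ _, by rintro b (rfl | hb); exacts [hirr _ haT, absurd hb (by simp)]⟩
    obtain ⟨m, hm, hmax⟩ := ih hFT hne
    by_cases hma : R m a
    · refine ⟨a, mem_insert _ _, ?_⟩
      rintro b (rfl | hb) hab
      · exact hirr _ haT hab
      · exact hmax b hb (htrans m (hFT hm) a haT b (hFT hb) hma hab)
    · refine ⟨m, mem_insert_of_mem _ hm, ?_⟩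
      rintro b (rfl | hb)
      · exact hma
      · exact hmax b hb

/-- A strict order with open lower sections on a subset of a compact space has an upper bound
in the closure of that subset. -/
theorem exists_mem_closure_maximal [CompactSpace X] {R : X → X → Prop} {T : Set X}
    (hT : T.Nonempty) (hirr : ∀ a ∈ T, ¬ R a a)
    (htrans : ∀ a ∈ T, ∀ b ∈ T, ∀ c ∈ T, R a b → R b c → R a c)
    (hopen : ∀ a ∈ T, IsOpen {s | R s a}) :
    ∃ s ∈ closure T, ∀ a ∈ T, ¬ R s a := by
  by_contra! hcon
  obtain ⟨F, hFT, hF, hcov⟩ := (isClosed_closure (s := T)).isCompact.elim_finite_subcover_image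
    hopen (fun s hs => by
      obtain ⟨a, ha, hsa⟩ := hcon s hs
      exact mem_iUnion₂.2 ⟨a, ha, hsa⟩)
  have hne : F.Nonempty := by
    obtain ⟨a, ha⟩ := hT
    obtain ⟨b, hb, -⟩ := mem_iUnion₂.1 (hcov (subset_closure ha))
    exact ⟨b, hb⟩
  obtain ⟨m, hm, hmax⟩ := exists_maximal_of_finite hirr htrans hF hFT hne
  obtain ⟨b, hb, hmb⟩ := mem_iUnion₂.1 (hcov (subset_closure (hFT hm)))
  exact hmax b hb hmb

end Separation

section Maps

variable {X : Type*} [TopologicalSpace X]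

/-- If `x` and `y` are both mapped away from each other, then there is a fixed point between
them. -/
theorem exists_fixed_separates [PreconnectedSpace X] [CompactSpace X]
    (hsep : ∀ p q : X, p ≠ q → ∃ z : X, Separates z p q) {D : Set X} (hD : IsPreconnected D)
    {g : X → X} (hg : ContinuousOn g D) {x y : X} (hx : x ∈ D) (hy : y ∈ D)
    (hgx : Separates x y (g x)) (hgy : Separates y x (g y)) :
    ∃ c, g c = c ∧ Separates c x y := by
  by_contra! hfix
  set G : Set X := {w | (w = x ∨ Separates w x y) ∧
    ∀ v, (v = x ∨ v = w ∨ Separates v x w) → Separates v (g v) y} with hG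
  have hxG : x ∈ G := by
    refine ⟨Or.inl rfl, ?_⟩
    rintro v (rfl | rfl | h)
    · exact hgx.symm
    · exact hgx.symm
    · obtain ⟨U, V, -, -, hd, -, h1, h2⟩ := h
      exact absurd h2 (disjoint_left.1 hd h1)
  obtain ⟨s, hsG, hmax⟩ := exists_mem_closure_maximal (R := fun s w => Separates w s y)
    ⟨x, hxG⟩ (fun a _ h => h.ne_left rfl)
    (fun a _ b _ c _ hab hbc => (hbc.symm.trans hab.symm).symm)
    (fun a _ => isOpen_setOf_separates_left a y)
  have hsI : s = x ∨ s = y ∨ Separates s x y := by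
    refine closure_minimal ?_ (isClosed_setOf_separates hsep x y) hsG
    rintro w ⟨rfl | h, -⟩
    exacts [Or.inl rfl, Or.inr (Or.inr h)]
  have hsD : s ∈ D := by
    rcases hsI with rfl | rfl | h
    exacts [hx, hy, h.mem_of_isPreconnected hD hx hy]
  have hGD : G ⊆ D := by
    rintro w ⟨rfl | h, -⟩
    exacts [hx, h.mem_of_isPreconnected hD hx hy]
  have hnhds : ∀ W : Set X, IsOpen W → g s ∈ W → ∃ N ∈ 𝓝 s, ∀ u ∈ N, u ∈ D → g u ∈ W := by
    intro W hW hgs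
    have := hg s hsD (hW.mem_nhds hgs)
    obtain ⟨N, hN, hNW⟩ := mem_nhdsWithin_iff_exists_mem_nhds_inter.1 this
    exact ⟨N, hN, fun u hu huD => hNW ⟨hu, huD⟩⟩
  have hleft : Separates s (g s) y := by
    by_contra hnot
    have hright : Separates s (g s) x := by
      rcases hsI with rfl | rfl | h
      · exact absurd hgx.symm hnot
      · exact hgy.symm
      · rcases h.left_or_right (r := g s) (fun h' => hfix s h' h) with h1 | h1
        · exact h1.symm
        · exact absurd h1 hnot
    obtain ⟨N, hN, hNW⟩ := hnhds _ (isOpen_setOf_separates_left s x) hright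
    obtain ⟨w, hwN, hwG⟩ := mem_closure_iff_nhds.1 hsG N hN
    have hsw : Separates s (g w) x := hNW w hwN (hGD hwG)
    have hwy : Separates w (g w) y := hwG.2 w (Or.inr (Or.inl rfl))
    have hne : s ≠ w := by
      rintro rfl
      exact hnot hwy
    have hws : Separates w (g w) s := by
      rcases hwy.left_or_right hne with h | h
      · exact h
      · exact absurd h (hmax w hwG)
    rcases hwG.1 with rfl | hwI
    · exact hws.symm.asymm hsw.symm
    · have hwxs : Separates w x s := by
        rcases hwI.left_or_right hne with h | h
        · exact h
        · exact absurd h (hmax w hwG)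
      rcases hsw.left_or_right hne.symm with h | h
      · exact hws.symm.asymm h.symm
      · exact hwxs.symm.asymm h
  have hsy : s ≠ y := hleft.ne_right.symm
  have hsx : s = x ∨ Separates s x y := by
    rcases hsI with h | h | h
    exacts [Or.inl h, absurd h hsy, Or.inr h]
  have hsmem : ∀ v, (v = x ∨ v = s ∨ Separates v x s) → Separates v (g v) y := by
    rintro v (rfl | rfl | h)
    · exact hgx.symm
    · exact hleft
    · obtain ⟨w, hvw, hwG⟩ := mem_closure_iff_nhds.1 hsG _
        ((isOpen_setOf_separates_right v x).mem_nhds h)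
      exact hwG.2 v (Or.inr (Or.inr hvw))
  obtain ⟨N, hN, hNW⟩ := hnhds _ (isOpen_setOf_separates_left s y) hleft
  obtain ⟨t, hty, htN, htv⟩ := exists_separates_mem_nhds hsep hsy hN
  have hbeyond : ∀ v, v ∈ N → Separates v s y → Separates v (g v) y := by
    intro v hvN hv
    have hvD : v ∈ D := hv.mem_of_isPreconnected hD hsD hy
    have hgv : Separates s (g v) y := hNW v hvN hvD
    have hne : g v ≠ v := by
      intro h
      rw [h] at hgv
      exact hv.asymm hgv
    rcases hv.left_or_right hne with h | h
    · rcases hgv.left_or_right hv.ne_left.symm with h1 | h1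
      · exact absurd h1.symm h.asymm
      · exact absurd h1 hv.asymm
    · exact h
  refine hmax t ⟨Or.inr ?_, ?_⟩ hty
  · rcases hsx with rfl | h
    · exact hty
    · exact (hty.symm.trans h.symm).symm
  · rintro v (rfl | rfl | h)
    · exact hgx.symm
    · exact hbeyond v htN hty
    · by_cases hvs : v = s
      · exact hsmem v (Or.inr (Or.inl hvs))
      rcases h.left_or_right (Ne.symm hvs) with h1 | h1
      · exact hsmem v (Or.inr (Or.inr h1))
      · exact hbeyond v (htv v h1) (h1.trans hty)

theorem isCutpoint_of_separates {D : Set X} (hD : IsPreconnected D) {c x y : X}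
    (hx : x ∈ D) (hy : y ∈ D) (h : Separates c x y) : IsCutpoint D c := by
  have hxc : x ∈ D \ {c} := ⟨hx, h.ne_left⟩
  have hyc : y ∈ D \ {c} := ⟨hy, h.ne_right⟩
  refine ⟨h.mem_of_isPreconnected hD hx hy, ?_⟩
  refine one_lt_encard_iff.2 ⟨_, _, mem_image_of_mem _ hxc, mem_image_of_mem _ hyc, ?_⟩
  intro heq
  have hmem : y ∈ connectedComponentIn (D \ {c}) x := heq ▸ mem_connectedComponentIn hyc
  have := h.mem_of_isPreconnected isPreconnected_connectedComponentIn
    (mem_connectedComponentIn hxc) hmem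
  exact (connectedComponentIn_subset _ _ this).2 rfl

theorem isEndpoint_of_not_isCutpoint {D : Set X} (hD : D.Nontrivial) {a : X} (ha : a ∈ D)
    (h : ¬ IsCutpoint D a) : IsEndpoint D a := by
  obtain ⟨b, hb, hba⟩ := hD.exists_ne a
  refine ⟨ha, le_antisymm (not_lt.1 fun h' => h ⟨ha, h'⟩) ?_⟩
  exact one_le_encard_iff_nonempty.2 ⟨_, mem_image_of_mem _ ⟨hb, hba⟩⟩

/-- A map that scrambles the boundary moves every non-fixed point `p` of `D` in a direction that
contains points of `D`. -/
theorem ScramblesBoundary.exists_separates [PreconnectedSpace X]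
    (hsep : ∀ p q : X, p ≠ q → ∃ z : X, Separates z p q) {D : Set X} (hD : IsPreconnected D)
    {f : D → X} (hf : ScramblesBoundary f) {p : D} (hp : f p ≠ p) :
    ∃ z ∈ D, Separates z (p : X) (f p) := by
  suffices ∃ d ∈ D, SameDirection (p : X) (f p) d by
    obtain ⟨d, hd, z, hz, hzd⟩ := this
    exact ⟨z, hzd.mem_of_isPreconnected hD p.2 hd, hz⟩
  by_cases hE : (p : X) ∈ growthSet D
  · obtain ⟨C, ⟨c, -, rfl⟩, hfC, d, hdC, hdD⟩ := hf p hE hp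
    refine ⟨d, hdD, ?_⟩
    have hC : ∀ u ∈ connectedComponentIn (univ \ {(p : X)}) c, u ≠ p :=
      fun u hu => (connectedComponentIn_subset _ _ hu).2
    by_contra h
    have := separates_of_not_sameDirection hsep hp (hC d hdC) h
    exact hC p (this.mem_of_isPreconnected isPreconnected_connectedComponentIn hfC hdC) rfl
  · have hDp : D ∈ 𝓝 (p : X) := by
      have : (p : X) ∉ closure (univ \ D) := fun h => hE ⟨h, p.2⟩
      rw [← compl_eq_univ_sdiff, closure_compl, notMem_compl_iff] at this
      exact mem_interior_iff_mem_nhds.1 this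
    by_contra! hno
    have hclosed : IsClosed {y | SameDirection (p : X) (f p) y} := by
      have : {y | SameDirection (p : X) (f p) y}ᶜ =
          interior D ∪ {y | y ≠ p ∧ ¬ SameDirection (p : X) (f p) y} := by
        ext y
        constructor
        · intro hy
          by_cases hyp : y = p
          · exact Or.inl (hyp ▸ mem_interior_iff_mem_nhds.2 hDp)
          · exact Or.inr ⟨hyp, hy⟩
        · rintro (hy | hy)
          · exact hno y (interior_subset hy)
          · exact hy.2
      rw [← isOpen_compl_iff, this]
      exact isOpen_interior.union (isOpen_setOf_not_sameDirection hsep _ _)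
    obtain ⟨z, hz⟩ := hsep p (f p) hp.symm
    have huniv := IsClopen.eq_univ ⟨hclosed, isOpen_setOf_sameDirection (p : X) (f p)⟩
      ⟨f p, z, hz, hz⟩
    exact hno p p.2 (eq_univ_iff_forall.1 huniv p)

end Maps

end DendriteFixedPoint

open DendriteFixedPoint in
theorem mainTheorem8 {X : Type*} [TopologicalSpace X]
    (hX : DendriteFixedPoint.IsDendrite X)
    (D₁ : Set X) (hD₁ : DendriteFixedPoint.IsDendrite D₁) (hnontriv : D₁.Nontrivial)
    (f : D₁ → X) (hf : Continuous f)
    (hscr : DendriteFixedPoint.ScramblesBoundary f)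
    (hrep : ∀ a : D₁, f a = a → DendriteFixedPoint.IsEndpoint D₁ (a : X) →
      DendriteFixedPoint.IsWeaklyRepelling f a) :
    ∃ c : D₁, f c = c ∧ DendriteFixedPoint.IsCutpoint D₁ (c : X) := by
  classical
  have := hX.compactSpace
  have := hX.connectedSpace
  have := hX.metrizableSpace
  have hsep := hX.exists_separates
  have hD : IsPreconnected D₁ :=
    isPreconnected_iff_preconnectedSpace.2 hD₁.connectedSpace.toPreconnectedSpace
  have hclosed : IsClosed D₁ := (isCompact_iff_compactSpace.2 hD₁.compactSpace).isClosed
  by_contra! hcon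
  set g : X → X := fun x => if h : x ∈ D₁ then f ⟨x, h⟩ else x with hgdef
  have hgf : ∀ a : D₁, g a = f a := fun a => by simp [hgdef]
  have hg : ContinuousOn g D₁ := by
    rw [continuousOn_iff_continuous_domRestrict]
    convert hf using 1
    exact funext hgf
  have hfix : ∀ c x y, x ∈ D₁ → y ∈ D₁ → Separates c x y → g c ≠ c := by
    intro c x y hx hy h hc
    have hcD := h.mem_of_isPreconnected hD hx hy
    exact hcon ⟨c, hcD⟩ (by rw [← hgf]; exact hc) (isCutpoint_of_separates hD hx hy h)
  have hkey : ∀ x ∈ D₁, ∀ y ∈ D₁, Separates x y (g x) → ¬ Separates y x (g y) := by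
    intro x hx y hy h1 h2
    obtain ⟨c, hc, hcxy⟩ := exists_fixed_separates hsep hD hg hx hy h1 h2
    exact hfix c x y hx hy hcxy hc
  set T : Set X := {x | x ∈ D₁ ∧ g x ≠ x} with hTdef
  have hT : T.Nonempty := by
    obtain ⟨p, hp, q, hq, hpq⟩ := hnontriv
    obtain ⟨z, hz⟩ := hsep p q hpq
    exact ⟨z, hz.mem_of_isPreconnected hD hp hq, hfix z p q hp hq hz⟩
  obtain ⟨p, hpT, hp⟩ := exists_mem_closure_maximal (R := fun x y => Separates y x (g y)) hT
    (fun a _ h => h.ne_left rfl)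
    (by
      intro x hx y hy z hz hxy hyz
      have hne : x ≠ z := by
        rintro rfl
        exact hkey x hx.1 y hy.1 hyz hxy
      by_contra hnot
      rcases hyz.left_or_right hne with h | h
      · rcases hxy.left_or_right hyz.ne_left.symm with h1 | h1
        · exact h.asymm h1.symm
        · exact hkey y hy.1 z hz.1 h1 hyz
      · exact hnot h)
    (fun a _ => isOpen_setOf_separates_left a (g a))
  have hpD : p ∈ D₁ := closure_minimal (fun x hx => hx.1) hclosed hpT
  have hpfix : g p = p := by
    by_contra hgp
    obtain ⟨z, hzD, hz⟩ := hscr.exists_separates hsep hD (p := ⟨p, hpD⟩) (by rwa [← hgf])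
    rw [← hgf] at hz
    have := hg p hpD ((isOpen_setOf_separates_right z p).mem_nhds hz)
    obtain ⟨N, hN, hNW⟩ := mem_nhdsWithin_iff_exists_mem_nhds_inter.1 this
    obtain ⟨w, hw, hwN, -⟩ := exists_separates_mem_nhds hsep hz.ne_left hN
    have hwD := hw.mem_of_isPreconnected hD hpD hzD
    have hwz : Separates z p (g w) := hNW ⟨hwN, hwD⟩
    have := hw.trans hwz
    exact hp w ⟨hwD, this.ne_right⟩ this
  have hpf : f ⟨p, hpD⟩ = p := by rw [← hgf]; exact hpfix
  obtain ⟨B, -, -, hB⟩ := hrep ⟨p, hpD⟩ hpf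
    (isEndpoint_of_not_isCutpoint hnontriv hpD (hcon ⟨p, hpD⟩ hpf))
  obtain ⟨x, -, ⟨hx, hxc⟩ | hx⟩ := hB univ Filter.univ_mem
  · exact hcon x hx hxc
  · rw [← hgf] at hx
    exact hp x ⟨x.2, hx.ne_right⟩ hx
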